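/- Let $(R,\mathfrak m)$ be a Noetherian local ring, and let $$A=\mathrm{gr}_{\mathfrak m}(R)=\bigoplus_{i\ge 0}\mathfrak m^i/\mathfrak m^{i+1}$$ be its associated graded ring with respect to $\mathfrak m$, with multiplication induced by $(a+\mathfrak m^{i+1})(b+\mathfrak m^{j+1})=ab+\mathfrak m^{i+j+1}$ for $a\in\mathfrak m^i$, $b\in\mathfrak m^j$. If $A$ is Cohen--Macaulay, then $R$ is Cohen--Macaulay. (A Noetherian local ring is Cohen--Macaulay if its depth, the supremum of the lengths of regular sequences in its maximal ideal, equals its Krull dimension; a Noetherian ring is Cohen--Macaulay if its localization at every maximal ideal is a Cohen--Macaulay local ring.) -/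

import Mathlib

open scoped DirectSum

namespace AssociatedGraded

section

variable {R : Type*} [CommRing R] (I : Ideal R)

/-- The degree `i` piece `I ^ i / I ^ (i + 1)` of the associated graded ring of `I`. -/
def Piece (i : ℕ) : Type _ := ↥(I ^ i) ⧸ (I ^ (i + 1)).submoduleOf (I ^ i)

instance instAddCommGroupPiece (i : ℕ) : AddCommGroup (Piece I i) :=
  inferInstanceAs (AddCommGroup (↥(I ^ i) ⧸ (I ^ (i + 1)).submoduleOf (I ^ i)))

instance instModulePiece (i : ℕ) : Module R (Piece I i) :=
  inferInstanceAs (Module R (↥(I ^ i) ⧸ (I ^ (i + 1)).submoduleOf (I ^ i)))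

/-- The class `[a] = a + I ^ (i + 1)` of an element `a` of `I ^ i`. -/
def cls (i : ℕ) : ↥(I ^ i) →ₗ[R] Piece I i := ((I ^ (i + 1)).submoduleOf (I ^ i)).mkQ

theorem cls_surjective (i : ℕ) : Function.Surjective (cls I i) :=
  Submodule.mkQ_surjective _

theorem cls_eq_zero_iff {i : ℕ} (a : ↥(I ^ i)) : cls I i a = 0 ↔ (a : R) ∈ I ^ (i + 1) := by
  unfold cls
  exact Submodule.Quotient.mk_eq_zero _

/-- The product of `a ∈ I ^ i` and `b ∈ I ^ j`, as an element of `I ^ (i + j)`. -/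
def mulPow {i j : ℕ} (a : ↥(I ^ i)) (b : ↥(I ^ j)) : ↥(I ^ (i + j)) :=
  ⟨(a : R) * b, pow_add I i j ▸ Ideal.mul_mem_mul a.2 b.2⟩

/-- The bilinear map `(a, b) ↦ [a * b]` on `I ^ i × I ^ j`. -/
def preMul (i j : ℕ) : ↥(I ^ i) →ₗ[R] ↥(I ^ j) →ₗ[R] Piece I (i + j) :=
  LinearMap.mk₂ R (fun a b => cls I (i + j) (mulPow I a b))
    (fun a a' b => by rw [← map_add]; congr 1; ext; simp [mulPow, add_mul])
    (fun c a b => by rw [← map_smul]; congr 1; ext; simp [mulPow, mul_assoc])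
    (fun a b b' => by rw [← map_add]; congr 1; ext; simp [mulPow, mul_add])
    (fun c a b => by rw [← map_smul]; congr 1; ext; simp [mulPow, mul_left_comm])

/-- The bilinear map `(a, [b]) ↦ [a * b]` on `I ^ i × I ^ j / I ^ (j + 1)`. -/
def preMul' (i j : ℕ) : ↥(I ^ i) →ₗ[R] Piece I j →ₗ[R] Piece I (i + j) :=
  (Submodule.liftQ ((I ^ (j + 1)).submoduleOf (I ^ j)) (preMul I i j).flip (by
    intro b hb
    have hb' : (b : R) ∈ I ^ (j + 1) := hb
    rw [LinearMap.mem_ker]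
    ext a
    refine (cls_eq_zero_iff I _).2 ?_
    rw [add_assoc, pow_add]
    exact Ideal.mul_mem_mul a.2 hb')).flip

/-- The multiplication `([a], [b]) ↦ [a * b]` of the pieces of degrees `i` and `j`. -/
def pieceMul (i j : ℕ) : Piece I i →ₗ[R] Piece I j →ₗ[R] Piece I (i + j) :=
  Submodule.liftQ ((I ^ (i + 1)).submoduleOf (I ^ i)) (preMul' I i j) (by
    intro a ha
    have ha' : (a : R) ∈ I ^ (i + 1) := ha
    rw [LinearMap.mem_ker]
    ext b
    obtain ⟨b, rfl⟩ := cls_surjective I j b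
    refine (cls_eq_zero_iff I _).2 ?_
    rw [add_right_comm, pow_add]
    exact Ideal.mul_mem_mul ha' b.2)

theorem pieceMul_cls {i j : ℕ} (a : ↥(I ^ i)) (b : ↥(I ^ j)) :
    pieceMul I i j (cls I i a) (cls I j b) = cls I (i + j) (mulPow I a b) := rfl

theorem mk_cls_eq {i j : ℕ} (h : i = j) (a : ↥(I ^ i)) (b : ↥(I ^ j)) (hab : (a : R) = b) :
    GradedMonoid.mk (A := Piece I) i (cls I i a) = GradedMonoid.mk j (cls I j b) := by
  subst h
  rw [Subtype.ext hab]

/-- The product `[a] * [b] = [a * b]` of homogeneous elements. -/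
instance instGMulPiece : GradedMonoid.GMul (Piece I) where
  mul a b := pieceMul I _ _ a b

/-- The unit `[1]`, in degree `0`. -/
instance instGOnePiece : GradedMonoid.GOne (Piece I) where
  one := cls I 0 ⟨1, by simp⟩

/-- The graded commutative ring structure on the pieces `I ^ i / I ^ (i + 1)`: the product is
`[a] * [b] = [a * b]` and the unit is `[1]`. -/
instance instGCommRingPiece : DirectSum.GCommRing (Piece I) where
  __ := instGMulPiece I
  __ := instGOnePiece I
  mul_zero a := by simp [GradedMonoid.GMul.mul]
  zero_mul b := by simp [GradedMonoid.GMul.mul]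
  mul_add a b c := by simp [GradedMonoid.GMul.mul]
  add_mul a b c := by simp [GradedMonoid.GMul.mul]
  one_mul := by
    rintro ⟨i, a⟩
    obtain ⟨a, rfl⟩ := cls_surjective I i a
    exact mk_cls_eq I (zero_add i) _ _ (one_mul (a : R))
  mul_one := by
    rintro ⟨i, a⟩
    obtain ⟨a, rfl⟩ := cls_surjective I i a
    exact mk_cls_eq I (add_zero i) _ _ (mul_one (a : R))
  mul_assoc := by
    rintro ⟨i, a⟩ ⟨j, b⟩ ⟨k, c⟩
    obtain ⟨a, rfl⟩ := cls_surjective I i a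
    obtain ⟨b, rfl⟩ := cls_surjective I j b
    obtain ⟨c, rfl⟩ := cls_surjective I k c
    exact mk_cls_eq I (add_assoc i j k) _ _ (mul_assoc (a : R) b c)
  mul_comm := by
    rintro ⟨i, a⟩ ⟨j, b⟩
    obtain ⟨a, rfl⟩ := cls_surjective I i a
    obtain ⟨b, rfl⟩ := cls_surjective I j b
    exact mk_cls_eq I (add_comm i j) _ _ (mul_comm (a : R) b)
  natCast n := cls I 0 ⟨n, by simp⟩
  natCast_zero := by
    rw [← map_zero (cls I 0)]; congr 1; ext; simp
  natCast_succ n := by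
    change _ = cls I 0 _ + cls I 0 ⟨1, by simp⟩
    rw [← map_add]; congr 1; ext; simp
  intCast n := cls I 0 ⟨n, by simp⟩
  intCast_ofNat n := by
    congr 1; ext; simp
  intCast_negSucc_ofNat n := by
    rw [← map_neg]; congr 1; ext; simp

end

end AssociatedGraded

/-- The associated graded ring `gr_I(R) = ⨁ i, I ^ i / I ^ (i + 1)` of the ideal `I`; its
commutative ring structure is the one of a direct sum of graded pieces. -/
abbrev AssociatedGradedRing {R : Type*} [CommRing R] (I : Ideal R) : Type _ :=
  ⨁ i, AssociatedGraded.Piece I i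

/-- The depth of a local ring: the supremum of the lengths of the regular sequences contained in
its maximal ideal. -/
noncomputable def localDepth (R : Type*) [CommRing R] [IsLocalRing R] : ℕ∞ :=
  ⨆ rs : {rs : List R // (∀ r ∈ rs, r ∈ IsLocalRing.maximalIdeal R) ∧
    RingTheory.Sequence.IsRegular R rs}, (rs.1.length : ℕ∞)

/-- A Cohen–Macaulay local ring: a Noetherian local ring whose depth is its Krull dimension. -/
class IsCohenMacaulayLocalRing (R : Type*) [CommRing R] : Prop extends
    IsLocalRing R, IsNoetherianRing R where
  depth_eq_dim : (localDepth R : WithBot ℕ∞) = ringKrullDim R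

/-- A Cohen–Macaulay ring: a Noetherian ring whose localization at every maximal ideal is a
Cohen–Macaulay local ring. -/
class IsCohenMacaulayRing (R : Type*) [CommRing R] : Prop extends IsNoetherianRing R where
  localization_atMaximal (p : Ideal R) [p.IsMaximal] :
    IsCohenMacaulayLocalRing (Localization.AtPrime p)

-- Regularity passes from initial forms back to the elements of `R`. The irrelevant ideal of `A` is
-- maximal because the degree 0 piece is the residue field, so the localization `Loc R` is
-- Cohen–Macaulay and has a regular sequence of length `dim (Loc R)`. Homogeneous prime avoidance
-- and the `Ext` criterion for depth turn it into one of the same length made of initial forms of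
-- positive degree (`exists_isRegular_initialFormLoc`).
--
-- By induction, the underlying elements form a weakly regular sequence in `R`
-- (`isWeaklyRegular_values`); the induction also carries that `J ⊓ 𝔪 ^ k` is contained in `∑ x * 𝔪
-- ^ (k - e)`, where `J` is the ideal they generate. The initial forms generate an ideal containing
-- a power of the maximal ideal of `Loc R`, and Nakayama moves this to `J`. Krull's height theorem
-- then bounds `dim R` by the length of the lifted sequence.

universe u

/-! ### Exchange of regular sequences and a Cohen–Macaulay criterion -/

section
open IsLocalRing RingTheory.Sequence CategoryTheory Abelian IsSMulRegular

/-- In the long exact sequence of `0 → N → N → N/xN → 0`, `Ext^i(k, N/xN)` sits between `Ext^i(k,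
N)` and `Ext^(i+1)(k, N)`, which vanish for `i < n`. So any regular `x` can replace the first
element of `rs`. -/
theorem exists_isRegular_quotSMulTop {B : Type u} [CommRing B] [IsLocalRing B] [IsNoetherianRing B]
    {N : Type u} [AddCommGroup N] [Module B N] [Module.Finite B N] [Nontrivial N] {n : ℕ}
    {rs : List B} (hlen : rs.length = n + 1) (hmem : ∀ r ∈ rs, r ∈ maximalIdeal B)
    (hrs : IsRegular N rs) {x : B} (hx : x ∈ maximalIdeal B) (hreg : IsSMulRegular N x) :
    ∃ rs' : List B, rs'.length = n ∧ (∀ r ∈ rs', r ∈ maximalIdeal B) ∧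
      IsRegular (QuotSMulTop x N) rs' := by
  have hlt (P : Type u) [AddCommGroup P] [Module B P] [Module.Finite B P] [Nontrivial P] :
      maximalIdeal B • (⊤ : Submodule B P) < ⊤ :=
    (Submodule.top_ne_ideal_smul_of_le_jacobson_annihilator
      (maximalIdeal_le_jacobson _)).symm.lt_top
  have := nontrivial_quotSMulTop_of_mem_maximalIdeal N hx
  have h1 : ∀ i < n + 1, Subsingleton (Ext (ModuleCat.of B (Shrink.{u} (B ⧸ maximalIdeal B)))
      (ModuleCat.of B N) i) := by
    refine ((ModuleCat.exists_isRegular_tfae (maximalIdeal B) (n + 1)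
      (ModuleCat.of B N) (hlt N)).out 3 1).mp ?_
    exact ⟨rs, hlen, hmem, hrs⟩
  refine ((ModuleCat.exists_isRegular_tfae (maximalIdeal B) n
    (ModuleCat.of B (QuotSMulTop x N)) (hlt _)).out 1 3).mp ?_
  intro i hi
  have zero1 := AddCommGrpCat.isZero_of_iff_subsingleton.mpr (h1 i (by omega))
  have zero2 := AddCommGrpCat.isZero_of_iff_subsingleton.mpr (h1 (i + 1) (by omega))
  have hreg' : IsSMulRegular (ModuleCat.of B N) x := hreg
  exact AddCommGrpCat.subsingleton_of_isZero <| ShortComplex.Exact.isZero_of_both_zeros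
    ((Ext.covariant_sequence_exact₃' _ hreg'.smulShortComplex_shortExact) i (i + 1) rfl)
    (zero1.eq_zero_of_src _) (zero2.eq_zero_of_tgt _)

/-- The first element of `rs` shows that the maximal ideal is not associated to `N`, so some `s ∈ S`
avoids all associated primes and is regular; then pass to `N/sN`. -/
theorem exists_isRegular_of_avoid {B : Type u} [CommRing B] [IsLocalRing B] [IsNoetherianRing B]
    (S : Set B) (hS : S ⊆ maximalIdeal B)
    (hav : ∀ T : Finset (Ideal B), (∀ p ∈ T, p.IsPrime ∧ p ≠ maximalIdeal B) →
      ∃ s ∈ S, ∀ p ∈ T, s ∉ p) (n : ℕ)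
    {N : Type u} [AddCommGroup N] [Module B N] [Module.Finite B N] [Nontrivial N]
    {rs : List B} (hlen : rs.length = n) (hmem : ∀ r ∈ rs, r ∈ maximalIdeal B)
    (hrs : IsRegular N rs) :
    ∃ ss : List B, ss.length = n ∧ (∀ s ∈ ss, s ∈ S) ∧ IsRegular N ss := by
  induction n generalizing N rs with
  | zero => exact ⟨[], rfl, by simp, IsRegular.nil B N⟩
  | succ n ih =>
    obtain ⟨b, rs', rfl⟩ := List.exists_cons_of_length_eq_add_one hlen
    have hb := ((isRegular_cons_iff N b rs').mp hrs).1
    have hbm : b ∈ maximalIdeal B := hmem b (by simp)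
    have hU := biUnion_associatedPrimes_eq_compl_regular B N
    obtain ⟨s, hsS, hs⟩ := hav (associatedPrimes.finite B N).toFinset (by
      intro p hp
      rw [Set.Finite.mem_toFinset] at hp
      refine ⟨IsAssociatedPrime.isPrime hp, fun h => ?_⟩
      have : b ∈ ⋃ p ∈ associatedPrimes B N, (p : Set B) :=
        Set.mem_biUnion hp (by rw [h]; exact hbm)
      rw [hU] at this
      exact this hb)
    have hsr : IsSMulRegular N s := by
      by_contra h
      have : s ∈ ⋃ p ∈ associatedPrimes B N, (p : Set B) := by rw [hU]; exact h
      obtain ⟨p, hp, hsp⟩ := Set.mem_iUnion₂.mp this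
      exact hs p (by simpa using hp) hsp
    have := nontrivial_quotSMulTop_of_mem_maximalIdeal N (hS hsS)
    obtain ⟨rs₁, h1, h2, h3⟩ := exists_isRegular_quotSMulTop hlen hmem hrs (hS hsS) hsr
    obtain ⟨ss, k1, k2, k3⟩ := ih h1 h2 h3
    exact ⟨s :: ss, by simp [k1], by simpa using ⟨hsS, k2⟩, .cons hsr k3⟩

theorem length_le_ringKrullDim {B : Type*} [CommRing B] [IsLocalRing B] [IsNoetherianRing B]
    {rs : List B} (hrs : IsRegular B rs) : (rs.length : WithBot ℕ∞) ≤ ringKrullDim B := by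
  have h := ringKrullDim_add_length_eq_ringKrullDim_of_isRegular rs hrs
  have hne : Ideal.ofList rs ≠ ⊤ := by
    have := hrs.2
    rw [smul_eq_mul, Ideal.mul_top] at this
    exact this.symm
  have := Ideal.Quotient.nontrivial_iff.mpr hne
  rw [← h]
  exact le_add_of_nonneg_left ringKrullDim_nonneg_of_nontrivial

theorem localDepth_le_ringKrullDim (B : Type*) [CommRing B] [IsLocalRing B]
    [IsNoetherianRing B] : (localDepth B : WithBot ℕ∞) ≤ ringKrullDim B := by
  obtain ⟨d, hd⟩ : ∃ d : ℕ∞, ringKrullDim B = d :=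
    ⟨_, (WithBot.coe_unbot _ ringKrullDim_ne_bot).symm⟩
  rw [hd]
  refine WithBot.coe_le_coe.mpr (iSup_le fun rs => ?_)
  have := length_le_ringKrullDim rs.2.2
  rw [hd] at this
  exact_mod_cast this

/-- The dimension is finite, so the supremum defining the depth is attained. -/
theorem exists_isRegular_length_eq_ringKrullDim (B : Type*) [CommRing B]
    [IsCohenMacaulayLocalRing B] :
    ∃ rs : List B, (∀ r ∈ rs, r ∈ maximalIdeal B) ∧ IsRegular B rs ∧
      (rs.length : WithBot ℕ∞) = ringKrullDim B := by
  have hdim := IsCohenMacaulayLocalRing.depth_eq_dim (R := B)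
  have hlt : ringKrullDim B < ⊤ := ringKrullDim_lt_top
  obtain ⟨d, hd⟩ : ∃ d : ℕ, localDepth B = d := by
    refine ⟨(localDepth B).toNat, (ENat.natCast_toNat fun h => ?_).symm⟩
    rw [← hdim, h] at hlt
    exact lt_irrefl _ hlt
  rw [← hdim, hd]
  have : Nonempty {rs : List B // (∀ r ∈ rs, r ∈ maximalIdeal B) ∧ IsRegular B rs} :=
    ⟨⟨[], by simp, IsRegular.nil B B⟩⟩
  obtain ⟨rs, hrs⟩ := ENat.exists_eq_iSup_of_lt_top
    (f := fun rs : {rs : List B // (∀ r ∈ rs, r ∈ maximalIdeal B) ∧ IsRegular B rs} =>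
      (rs.1.length : ℕ∞)) (by
        change localDepth B < ⊤
        rw [hd]; exact ENat.natCast_lt_top d)
  refine ⟨rs.1, rs.2.1, rs.2.2, ?_⟩
  change (rs.1.length : ℕ∞) = localDepth B at hrs
  rw [hd] at hrs
  exact_mod_cast hrs

/-- A local ring with a regular sequence generating an ideal that contains a power of the maximal
ideal is Cohen–Macaulay. -/
theorem isCohenMacaulayLocalRing_of_isRegular {R : Type*} [CommRing R] [IsLocalRing R]
    [IsNoetherianRing R] {rs : List R} (hmem : ∀ r ∈ rs, r ∈ maximalIdeal R)
    (hrs : IsRegular R rs) {n : ℕ} (hn : maximalIdeal R ^ n ≤ Ideal.ofList rs) :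
    IsCohenMacaulayLocalRing R where
  depth_eq_dim := by
    classical
    refine (localDepth_le_ringKrullDim R).antisymm ?_
    have hle : Ideal.ofList rs ≤ maximalIdeal R := Ideal.span_le.mpr hmem
    have hmin : maximalIdeal R ∈ (Ideal.ofList rs).minimalPrimes := by
      refine ⟨⟨inferInstance, hle⟩, fun p ⟨hp, hp'⟩ _ => ?_⟩
      exact hp.le_of_pow_le (hn.trans hp')
    -- Krull's height theorem.
    have h1 : (maximalIdeal R).height ≤ rs.length := by
      have : Ideal.ofList rs = Ideal.span (rs.toFinset : Set R) := by simp [Ideal.ofList]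
      rw [this] at hmin
      refine (Ideal.height_le_card_of_mem_minimalPrimes_span_finset hmin).trans ?_
      exact_mod_cast rs.toFinset_card_le
    have h2 : (rs.length : ℕ∞) ≤ localDepth R :=
      le_iSup (fun rs : {rs : List R // (∀ r ∈ rs, r ∈ maximalIdeal R) ∧ IsRegular R rs} =>
        (rs.1.length : ℕ∞)) ⟨rs, hmem, hrs⟩
    rw [← maximalIdeal_height_eq_ringKrullDim]
    exact WithBot.coe_le_coe.mpr (h1.trans h2)
end

/-! ### Homogeneous prime avoidance -/

section HomogeneousAvoidance

/-- **Homogeneous prime avoidance**: if each of finitely many primes misses some homogeneous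
element of positive degree, then a single homogeneous element of positive degree is missed by all
of them. -/
theorem exists_homogeneous_notMem {A : Type*} [CommRing A] (H : ℕ → AddSubmonoid A)
    [SetLike.GradedMonoid H] (T : Finset (Ideal A))
    (hT : ∀ p ∈ T, p.IsPrime ∧ ∃ e, 0 < e ∧ ∃ y ∈ H e, y ∉ p) :
    ∃ e, 0 < e ∧ ∃ y ∈ H e, ∀ p ∈ T, y ∉ p := by
  classical
  induction T using Finset.strongInduction with
  | H T ih =>
    by_contra! hcon
    have key : ∀ p ∈ T, ∃ e, 0 < e ∧ ∃ y ∈ H e, y ∈ p ∧ ∀ q ∈ T, q ≠ p → y ∉ q := by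
      intro p hp
      obtain ⟨e, he, y, hy, hyT⟩ := ih (T.erase p) (Finset.erase_ssubset hp)
        fun q hq => hT q (Finset.mem_of_mem_erase hq)
      obtain ⟨q, hq, hyq⟩ := hcon e he y hy
      have : q = p := by
        by_contra h
        exact hyT q (Finset.mem_erase.mpr ⟨h, hq⟩) hyq
      subst this
      exact ⟨e, he, y, hy, hyq, fun q' hq' hne => hyT q' (Finset.mem_erase.mpr ⟨hne, hq'⟩)⟩
    choose! e he y hy hyp hyq using key
    rcases T.eq_empty_or_nonempty with rfl | ⟨p, hp⟩
    · obtain ⟨p, hp, -⟩ := hcon 1 one_pos 0 (zero_mem _)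
      simp at hp
    rcases (T.erase p).eq_empty_or_nonempty with hE | hE
    · obtain ⟨f, hf, z, hz, hzp⟩ := (hT p hp).2
      obtain ⟨q, hq, hzq⟩ := hcon f hf z hz
      have : q = p := by
        by_contra h
        have : q ∈ T.erase p := Finset.mem_erase.mpr ⟨h, hq⟩
        simp [hE] at this
      exact hzp (this ▸ hzq)
    -- Each `y q` lies in `q` alone, so `a` misses only `p` and `y p` misses all the others. The
    -- exponents put `a ^ e p` and `y p ^ s` in the same degree, and their sum misses every prime of
    -- `T`.
    set a := ∏ q ∈ T.erase p, y q
    set s := ∑ q ∈ T.erase p, e q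
    have ha : a ∈ H s := SetLike.prod_mem_graded H _ _ fun q hq => hy q (Finset.mem_of_mem_erase hq)
    have hs : 0 < s := Finset.sum_pos (fun q hq => he q (Finset.mem_of_mem_erase hq)) hE
    have h1 : a ^ e p ∈ H (e p * s) := SetLike.pow_mem_graded (e p) ha
    have h2 : y p ^ s ∈ H (e p * s) := by
      rw [mul_comm]; exact SetLike.pow_mem_graded s (hy p hp)
    obtain ⟨q, hq, hzq⟩ := hcon _ (mul_pos (he p hp) hs) _ (add_mem h1 h2)
    have := (hT q hq).1
    by_cases hqp : q = p
    · subst hqp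
      have : a ^ e q ∈ q := (q.add_mem_iff_left (q.pow_mem_of_mem (hyp q hq) s hs)).mp hzq
      obtain ⟨q', hq', h⟩ := (Ideal.IsPrime.prod_mem_iff).mp
        (Ideal.IsPrime.mem_of_pow_mem ‹_› _ this)
      exact hyq q' (Finset.mem_of_mem_erase hq') q hq (Finset.ne_of_mem_erase hq').symm h
    · have haq : a ∈ q := Ideal.IsPrime.prod_mem_iff.mpr
        ⟨q, Finset.mem_erase.mpr ⟨hqp, hq⟩, hyp q hq⟩
      have : y p ^ s ∈ q := (q.add_mem_iff_right (q.pow_mem_of_mem haq _ (he p hp))).mp hzq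
      exact hyq p hp q hq hqp (Ideal.IsPrime.mem_of_pow_mem ‹_› _ this)

end HomogeneousAvoidance

/-! ### Leading forms and the irrelevant ideal -/

namespace AssociatedGraded

section

variable {R : Type*} [CommRing R] (I : Ideal R)

/-- The class of `x ∈ I ^ e` in degree `e` of the associated graded ring. -/
def leading (e : ℕ) (x : ↥(I ^ e)) : AssociatedGradedRing I :=
  DirectSum.of (Piece I) e (cls I e x)

theorem leading_mul {e f : ℕ} (x : ↥(I ^ e)) (y : ↥(I ^ f)) :
    leading I e x * leading I f y = leading I (e + f) (mulPow I x y) :=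
  DirectSum.of_mul_of _ _

theorem leading_add {e : ℕ} (x y : ↥(I ^ e)) :
    leading I e (x + y) = leading I e x + leading I e y := by
  simp [leading]

theorem leading_eq_zero {e : ℕ} (x : ↥(I ^ e)) (hx : (x : R) ∈ I ^ (e + 1)) :
    leading I e x = 0 := by
  rw [leading, (cls_eq_zero_iff I x).mpr hx, map_zero]

theorem leading_congr {e f : ℕ} (h : e = f) (x : ↥(I ^ e)) (y : ↥(I ^ f)) (hxy : (x : R) = y) :
    leading I e x = leading I f y := by
  subst h
  rw [Subtype.ext hxy]

theorem leading_apply_self {e : ℕ} (x : ↥(I ^ e)) : leading I e x e = cls I e x :=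
  DirectSum.of_eq_same _ _

theorem mem_mrange_of_iff {e : ℕ} {y : AssociatedGradedRing I} :
    y ∈ AddMonoidHom.mrange (DirectSum.of (Piece I) e) ↔ ∃ x, leading I e x = y := by
  constructor
  · rintro ⟨b, rfl⟩
    obtain ⟨x, rfl⟩ := cls_surjective I e b
    exact ⟨x, rfl⟩
  · rintro ⟨x, rfl⟩
    exact ⟨_, rfl⟩

instance gradedMonoid_mrange_of :
    SetLike.GradedMonoid fun e => AddMonoidHom.mrange (DirectSum.of (Piece I) e) where
  one_mem := ⟨_, rfl⟩
  mul_mem := by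
    rintro i j _ _ ⟨a, rfl⟩ ⟨b, rfl⟩
    exact ⟨_, (DirectSum.of_mul_of a b).symm⟩

theorem induction_leading {P : AssociatedGradedRing I → Prop} (c : AssociatedGradedRing I)
    (h0 : P 0) (hl : ∀ i x, P (leading I i x)) (ha : ∀ a b, P a → P b → P (a + b)) : P c := by
  induction c using DirectSum.induction_on with
  | zero => exact h0
  | of i b =>
    obtain ⟨x, rfl⟩ := cls_surjective I i b
    exact hl i x
  | add a b iha ihb => exact ha a b iha ihb

theorem leading_mul_apply_add {e : ℕ} (x : ↥(I ^ e)) (c : AssociatedGradedRing I) (j : ℕ) :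
    (leading I e x * c) (e + j) = pieceMul I e j (cls I e x) (c j) := by
  induction c using induction_leading with
  | h0 => simp
  | hl i b =>
    rw [leading_mul]
    by_cases h : i = j
    · subst h
      rw [leading_apply_self, leading_apply_self, pieceMul_cls]
    · rw [leading, leading, DirectSum.of_eq_of_ne _ _ _ (by omega),
        DirectSum.of_eq_of_ne _ _ _ (by omega), map_zero]
  | ha a b iha ihb => simp [mul_add, DirectSum.add_apply, iha, ihb]

theorem leading_mul_apply_of_lt {e : ℕ} (x : ↥(I ^ e)) (c : AssociatedGradedRing I) {k : ℕ}
    (hk : k < e) : (leading I e x * c) k = 0 := by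
  induction c using induction_leading with
  | h0 => simp
  | hl i b => rw [leading_mul, leading, DirectSum.of_eq_of_ne _ _ _ (by omega)]
  | ha a b iha ihb => simp [mul_add, DirectSum.add_apply, iha, ihb]

/-- The ideal of elements of the associated graded ring with vanishing degree `0` component. -/
def irrelevant : Ideal (AssociatedGradedRing I) where
  carrier := {a | a 0 = 0}
  add_mem' {a b} ha hb := by
    simp only [Set.mem_ofPred_eq, DirectSum.add_apply] at *
    rw [ha, hb, add_zero]
  zero_mem' := rfl
  smul_mem' c a ha := by
    simp only [Set.mem_ofPred_eq, smul_eq_mul] at *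
    induction c using induction_leading with
    | h0 => simp
    | hl i x =>
      rcases i.eq_zero_or_pos with rfl | hi
      · exact (leading_mul_apply_add I x a 0).trans (by rw [ha, map_zero])
      · exact leading_mul_apply_of_lt I x a hi
    | ha a b iha ihb => simp [add_mul, DirectSum.add_apply, iha, ihb]

theorem mem_irrelevant {a : AssociatedGradedRing I} : a ∈ irrelevant I ↔ a 0 = 0 := Iff.rfl

theorem leading_mem_irrelevant {e : ℕ} (he : 0 < e) (x : ↥(I ^ e)) :
    leading I e x ∈ irrelevant I := by
  rw [mem_irrelevant, leading, DirectSum.of_eq_of_ne _ _ _ (by omega)]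

theorem irrelevant_le {P : Ideal (AssociatedGradedRing I)}
    (h : ∀ e, 0 < e → ∀ x, leading I e x ∈ P) : irrelevant I ≤ P := by
  classical
  intro a ha
  rw [← DirectSum.sum_support_of a]
  refine P.sum_mem fun i hi => ?_
  rcases i.eq_zero_or_pos with rfl | hi
  · rw [(mem_irrelevant I).mp ha, map_zero]; exact P.zero_mem
  · obtain ⟨x, hx⟩ := cls_surjective I i (a i)
    rw [← hx]
    exact h i hi x

theorem leading_mem_irrelevant_pow (n : ℕ) {r : R} (h : r ∈ I ^ n) :
    leading I n ⟨r, h⟩ ∈ irrelevant I ^ n := by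
  induction n generalizing r with
  | zero => simp
  | succ n ih =>
    -- The membership proof is part of the predicate, so that induction over sums of products
    -- applies.
    suffices ∃ h : r ∈ I ^ (n + 1), leading I (n + 1) ⟨r, h⟩ ∈ irrelevant I ^ (n + 1) from this.2
    have h' := h
    rw [pow_succ] at h'
    refine Submodule.mul_induction_on h' (fun a ha b hb => ?_) fun a b ⟨ha, ha'⟩ ⟨hb, hb'⟩ => ?_
    · refine ⟨by rw [pow_succ]; exact Ideal.mul_mem_mul ha hb, ?_⟩
      rw [pow_succ]
      have hb1 : b ∈ I ^ 1 := by simpa using hb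
      exact leading_mul I ⟨a, ha⟩ ⟨b, hb1⟩ ▸
        Ideal.mul_mem_mul (ih ha) (leading_mem_irrelevant I one_pos _)
    · exact ⟨add_mem ha hb, by
        have := add_mem ha' hb'
        rwa [← leading_add] at this⟩

end

section

open IsLocalRing

variable {R : Type*} [CommRing R] [IsLocalRing R]

/-- Non-units of `R` lie in the maximal ideal, so their class in degree 0 vanishes. -/
theorem exists_isUnit_cls_of_notMem_irrelevant {a : AssociatedGradedRing (maximalIdeal R)}
    (ha : a ∉ irrelevant (maximalIdeal R)) :
    ∃ u : ↥(maximalIdeal R ^ 0), IsUnit (u : R) ∧ cls _ 0 u = a 0 := by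
  obtain ⟨u, hu⟩ := cls_surjective (maximalIdeal R) 0 (a 0)
  refine ⟨u, ?_, hu⟩
  by_contra h
  refine ha ((mem_irrelevant _).mpr ?_)
  rw [← hu, cls_eq_zero_iff]
  simpa using h

instance isMaximal_irrelevant : (irrelevant (maximalIdeal R)).IsMaximal := by
  have h1 : (1 : AssociatedGradedRing (maximalIdeal R)) = leading _ 0 ⟨1, by simp⟩ := rfl
  refine Ideal.isMaximal_iff.mpr ⟨fun h => ?_, fun J a hJ ha haJ => ?_⟩
  · rw [mem_irrelevant, h1, leading_apply_self, cls_eq_zero_iff] at h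
    simp at h
  · obtain ⟨u, hu, hua⟩ := exists_isUnit_cls_of_notMem_irrelevant ha
    obtain ⟨v, hv⟩ := hu.exists_left_inv
    set w := leading (maximalIdeal R) 0 ⟨v, by simp⟩ * a with hw
    have hwJ : w ∈ J := J.mul_mem_left _ haJ
    have : 1 - w ∈ irrelevant (maximalIdeal R) := by
      have hw0 : w 0 = cls (maximalIdeal R) 0 ⟨1, by simp⟩ := by
        refine (leading_mul_apply_add _ _ a 0).trans ?_
        rw [← hua, pieceMul_cls]
        congr 1
        exact Subtype.ext hv
      rw [mem_irrelevant, DirectSum.sub_apply, h1, leading_apply_self, hw0, sub_self]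
    have := J.add_mem (hJ this) hwJ
    rwa [sub_add_cancel] at this

end

end AssociatedGraded

/-! ### Lifting regularity by one element -/

section Lifting

open IsLocalRing

variable {R : Type*} [CommRing R] [IsLocalRing R]

/-- Krull's intersection theorem in `R ⧸ J`. -/
theorem mem_of_forall_mem_sup_pow [IsNoetherianRing R] {J : Ideal R} {r : R}
    (h : ∀ k, r ∈ J ⊔ maximalIdeal R ^ k) : r ∈ J := by
  have hbot := Ideal.iInf_pow_smul_eq_bot_of_isLocalRing (M := R ⧸ J) (maximalIdeal R)
    (Ideal.IsMaximal.ne_top inferInstance)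
  have hz : Ideal.Quotient.mk J r ∈
      (⨅ i : ℕ, maximalIdeal R ^ i • (⊤ : Submodule R (R ⧸ J))) := by
    rw [Submodule.mem_iInf]
    intro k
    obtain ⟨s, hs, t, ht, rfl⟩ := Submodule.mem_sup.mp (h k)
    rw [map_add, Ideal.Quotient.eq_zero_iff_mem.mpr hs, zero_add]
    have := Submodule.smul_mem_smul ht (Submodule.mem_top (x := Ideal.Quotient.mk J 1))
    rwa [← Ideal.Quotient.mk_eq_mk, ← Submodule.Quotient.mk_smul, smul_eq_mul, mul_one] at this
  rw [hbot, Submodule.mem_bot] at hz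
  exact Ideal.Quotient.eq_zero_iff_mem.mp hz

variable {J : Ideal R} {F : ℕ → Ideal R} {e : ℕ} {x : R}

/-- `F k` plays the degree `k` initial part of `J`, and `hreg` says that the initial form of `x` is
regular modulo it. If `r ≡ t` modulo `J` with `t ∈ 𝔪 ^ k`, then `x * t ∈ J ⊓ 𝔪 ^ (e + k)`, so `t`
can be pushed into `𝔪 ^ (k + 1)`. -/
theorem mem_of_mul_mem_of_initial [IsNoetherianRing R] (hF : ∀ k, F k ≤ J)
    (hJ : ∀ k, J ⊓ maximalIdeal R ^ k ≤ F k) (hx : x ∈ maximalIdeal R ^ e)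
    (hreg : ∀ k, ∀ r ∈ maximalIdeal R ^ k,
      x * r ∈ F (e + k) ⊔ maximalIdeal R ^ (e + k + 1) → r ∈ F k ⊔ maximalIdeal R ^ (k + 1))
    {r : R} (hr : x * r ∈ J) : r ∈ J := by
  refine mem_of_forall_mem_sup_pow fun k => ?_
  induction k with
  | zero => simp
  | succ k ih =>
    obtain ⟨s, hs, t, ht, rfl⟩ := Submodule.mem_sup.mp ih
    have hxt : x * t ∈ J := by
      have := J.sub_mem hr (J.mul_mem_left x hs)
      rwa [mul_add, add_sub_cancel_left] at this
    have hxt' : x * t ∈ maximalIdeal R ^ (e + k) := by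
      rw [pow_add]; exact Ideal.mul_mem_mul hx ht
    have := hreg k t ht (Ideal.mem_sup_left (hJ _ ⟨hxt, hxt'⟩))
    exact add_mem (Ideal.mem_sup_left hs) (sup_le_sup_right (hF k) _ this)

theorem sup_span_inf_pow_le_of_initial (hF : ∀ k, F k ≤ J)
    (hJ : ∀ k, J ⊓ maximalIdeal R ^ k ≤ F k) (hx : x ∈ maximalIdeal R ^ e)
    (hreg : ∀ k, ∀ r ∈ maximalIdeal R ^ k,
      x * r ∈ F (e + k) ⊔ maximalIdeal R ^ (e + k + 1) → r ∈ F k ⊔ maximalIdeal R ^ (k + 1))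
    (k : ℕ) :
    (J ⊔ Ideal.span {x}) ⊓ maximalIdeal R ^ k ≤
      F k ⊔ Ideal.span {x} * maximalIdeal R ^ (k - e) := by
  rintro z ⟨hz, hzk⟩
  -- While `l < k - e`, `x * r` agrees with `-s ∈ F (e + l)` modulo `𝔪 ^ (e + l + 1)`. By `hreg`,
  -- `r` is then in `F l` up to `𝔪 ^ (l + 1)`, and `x` times the `F l` part is absorbed into `s`.
  have key : ∀ l ≤ k - e, ∃ r ∈ maximalIdeal R ^ l, ∃ s ∈ J, s + x * r = z := by
    intro l
    induction l with
    | zero =>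
      intro _
      obtain ⟨s, hs, t, ht, rfl⟩ := Submodule.mem_sup.mp hz
      obtain ⟨r, rfl⟩ := Ideal.mem_span_singleton'.mp ht
      exact ⟨r, by simp, s, hs, by rw [mul_comm]⟩
    | succ l ih =>
      intro hl
      obtain ⟨r, hr, s, hs, rfl⟩ := ih (by omega)
      have hxr : x * r ∈ maximalIdeal R ^ (e + l) := by
        rw [pow_add]; exact Ideal.mul_mem_mul hx hr
      have hs' : s ∈ maximalIdeal R ^ (e + l) := by
        have := sub_mem (Ideal.pow_le_pow_right (by omega : e + l ≤ k) hzk) hxr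
        rwa [add_sub_cancel_right] at this
      have h1 : x * r ∈ F (e + l) ⊔ maximalIdeal R ^ (e + l + 1) := by
        have := sub_mem
          (Ideal.mem_sup_right (Ideal.pow_le_pow_right (by omega : e + l + 1 ≤ k) hzk))
          (Ideal.mem_sup_left (T := maximalIdeal R ^ (e + l + 1)) (hJ _ ⟨hs, hs'⟩))
        rwa [add_sub_cancel_left] at this
      obtain ⟨u, hu, t, ht, rfl⟩ := Submodule.mem_sup.mp (hreg l r hr h1)
      exact ⟨t, ht, s + x * u, add_mem hs (J.mul_mem_left x (hF l hu)), by ring⟩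
  obtain ⟨r, hr, s, hs, rfl⟩ := key (k - e) le_rfl
  have hxr : x * r ∈ maximalIdeal R ^ k := by
    -- If `k < e`, then `k - e = 0` and the exponent is `e`, still at least `k`.
    have : x * r ∈ maximalIdeal R ^ (e + (k - e)) := by
      rw [pow_add]; exact Ideal.mul_mem_mul hx hr
    exact Ideal.pow_le_pow_right (by omega) this
  have hs' : s ∈ maximalIdeal R ^ k := by
    have := sub_mem hzk hxr
    rwa [add_sub_cancel_right] at this
  exact add_mem (Ideal.mem_sup_left (hJ k ⟨hs, hs'⟩))
    (Ideal.mem_sup_right (Ideal.mul_mem_mul (Ideal.mem_span_singleton_self x) hr))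

end Lifting

/-! ### Ideals of initial forms, degree by degree -/

namespace AssociatedGraded

open RingTheory.Sequence

section

variable {R : Type*} [CommRing R] (I : Ideal R)

/-- The class in the associated graded ring of an element of `I ^ e` with given `e`. -/
def initialForm (p : Σ e, ↥(I ^ e)) : AssociatedGradedRing I := leading I p.1 p.2

/-- The ideal `∑ x * I ^ (k - e)`, the sum ranging over the elements `x ∈ I ^ e` in a list. -/
def truncation (L : List (Σ e, ↥(I ^ e))) (k : ℕ) : Ideal R :=
  (L.map fun p => Ideal.span {(p.2 : R)} * I ^ (k - p.1)).sum

/-- The underlying elements of `R` of a list of elements of powers of `I`. -/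
def values (L : List (Σ e, ↥(I ^ e))) : List R := L.map fun p => (p.2 : R)

theorem truncation_cons (p : Σ e, ↥(I ^ e)) (L : List (Σ e, ↥(I ^ e))) (k : ℕ) :
    truncation I (p :: L) k = Ideal.span {(p.2 : R)} * I ^ (k - p.1) ⊔ truncation I L k := by
  simp [truncation, Submodule.add_eq_sup]

theorem truncation_concat (p : Σ e, ↥(I ^ e)) (L : List (Σ e, ↥(I ^ e))) (k : ℕ) :
    truncation I (L ++ [p]) k = truncation I L k ⊔ Ideal.span {(p.2 : R)} * I ^ (k - p.1) := by
  simp [truncation, Submodule.add_eq_sup]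

theorem truncation_le (L : List (Σ e, ↥(I ^ e))) (k : ℕ) :
    truncation I L k ≤ Ideal.ofList (values I L) := by
  induction L with
  | nil => simp [truncation]
  | cons p L ih =>
    rw [truncation_cons, values, List.map_cons, Ideal.ofList_cons]
    exact sup_le_sup (Ideal.mul_le_inf.trans inf_le_left) ih

/-- Together with `exists_cls_eq_apply_of_mem`, this identifies the image of `truncation I L k` in
degree `k` with the degree `k` part of the ideal of initial forms. -/
theorem leading_mem_of_mem_truncation (L : List (Σ e, ↥(I ^ e))) {k : ℕ} {r : R}
    (hr : r ∈ truncation I L k) :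
    ∃ h : r ∈ I ^ k, leading I k ⟨r, h⟩ ∈ Ideal.ofList (L.map (initialForm I)) := by
  induction L generalizing r with
  | nil =>
    obtain rfl : r = 0 := by simpa [truncation] using hr
    refine ⟨zero_mem _, ?_⟩
    rw [leading_eq_zero I _ (zero_mem _)]
    exact zero_mem _
  | cons p L ih =>
    rw [truncation_cons] at hr
    obtain ⟨a, ha, b, hb, rfl⟩ := Submodule.mem_sup.mp hr
    obtain ⟨t, ht, rfl⟩ := Ideal.mem_span_singleton_mul.mp ha
    obtain ⟨hb, hb'⟩ := ih hb
    rw [List.map_cons, Ideal.ofList_cons]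
    have hat : (p.2 : R) * t ∈ I ^ (p.1 + (k - p.1)) := by
      rw [pow_add]; exact Ideal.mul_mem_mul p.2.2 ht
    have hak : (p.2 : R) * t ∈ I ^ k := Ideal.pow_le_pow_right (by omega) hat
    refine ⟨add_mem hak hb, ?_⟩
    have ha' : leading I k ⟨(p.2 : R) * t, hak⟩ ∈ Ideal.span {initialForm I p} := by
      by_cases hk : p.1 ≤ k
      · rw [← leading_congr I (by omega : p.1 + (k - p.1) = k) (mulPow I p.2 ⟨t, ht⟩)
          ⟨(p.2 : R) * t, hak⟩ rfl, ← leading_mul]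
        exact Ideal.mul_mem_right _ _ (Ideal.mem_span_singleton_self _)
      -- Here `k < p.1`, so the product lies in `I ^ (k + 1)`.
      · rw [leading_eq_zero]
        · exact zero_mem _
        · exact Ideal.mul_mem_right _ _ (Ideal.pow_le_pow_right (by omega) p.2.2)
    exact leading_add I ⟨_, hak⟩ ⟨b, hb⟩ ▸
      add_mem (Ideal.mem_sup_left ha') (Ideal.mem_sup_right hb')

theorem exists_cls_eq_apply_of_mem (L : List (Σ e, ↥(I ^ e))) {c : AssociatedGradedRing I}
    (hc : c ∈ Ideal.ofList (L.map (initialForm I))) (k : ℕ) :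
    ∃ r : ↥(I ^ k), (r : R) ∈ truncation I L k ∧ cls I k r = c k := by
  induction L generalizing c with
  | nil =>
    obtain rfl : c = 0 := by simpa using hc
    exact ⟨0, zero_mem _, map_zero _⟩
  | cons p L ih =>
    rw [List.map_cons, Ideal.ofList_cons] at hc
    obtain ⟨a, ha, b, hb, rfl⟩ := Submodule.mem_sup.mp hc
    obtain ⟨d, rfl⟩ := Ideal.mem_span_singleton.mp ha
    obtain ⟨s, hs, hsb⟩ := ih hb
    rw [truncation_cons]
    suffices ∃ r : ↥(I ^ k), (r : R) ∈ Ideal.span {(p.2 : R)} * I ^ (k - p.1) ∧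
        cls I k r = (initialForm I p * d) k by
      obtain ⟨r, hr, hrd⟩ := this
      exact ⟨r + s, add_mem (Ideal.mem_sup_left hr) (Ideal.mem_sup_right hs), by
        rw [map_add, hrd, hsb, DirectSum.add_apply]⟩
    by_cases hk : p.1 ≤ k
    · obtain ⟨j, rfl⟩ := Nat.exists_eq_add_of_le hk
      obtain ⟨t, ht⟩ := cls_surjective I j (d j)
      refine ⟨mulPow I p.2 t, ?_, ?_⟩
      · rw [Nat.add_sub_cancel_left]
        exact Ideal.mul_mem_mul (Ideal.mem_span_singleton_self _) t.2
      · rw [initialForm, leading_mul_apply_add, ← ht, pieceMul_cls]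
    · refine ⟨0, zero_mem _, ?_⟩
      rw [initialForm, leading_mul_apply_of_lt I _ _ (by omega), map_zero]

end

/-! ### Localization and lifting of whole sequences -/

section

open IsLocalRing

variable {R : Type*} [CommRing R] [IsLocalRing R]

/-- The degree `k` component of the product is the class of `u * r` for a unit `u`, so the
denominators of `Loc R` do no harm. -/
theorem mem_truncation_sup_of_mul_leading_mem (L : List (Σ e, ↥(maximalIdeal R ^ e))) {k : ℕ}
    (r : ↥(maximalIdeal R ^ k)) {s : AssociatedGradedRing (maximalIdeal R)}
    (hs : s ∉ irrelevant (maximalIdeal R))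
    (h : s * leading _ k r ∈ Ideal.ofList (L.map (initialForm (maximalIdeal R)))) :
    (r : R) ∈ truncation _ L k ⊔ maximalIdeal R ^ (k + 1) := by
  obtain ⟨u, hu, hus⟩ := exists_isUnit_cls_of_notMem_irrelevant hs
  obtain ⟨t, ht, htc⟩ := exists_cls_eq_apply_of_mem _ L h k
  have h1 : (s * leading _ k r) k = cls _ k ((u : R) • r) := by
    rw [mul_comm]
    refine (leading_mul_apply_add _ r s 0).trans ?_
    rw [← hus, pieceMul_cls]
    congr 1
    exact Subtype.ext (mul_comm _ _)
  rw [h1, ← sub_eq_zero, ← map_sub, cls_eq_zero_iff] at htc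
  have h2 : (u : R) * r ∈ truncation _ L k ⊔ maximalIdeal R ^ (k + 1) := by
    have := sub_mem (Ideal.mem_sup_left (T := maximalIdeal R ^ (k + 1)) ht)
      (Ideal.mem_sup_right htc)
    simpa using this
  exact (Ideal.unit_mul_mem_iff_mem _ hu).mp h2

/-- The localization of the associated graded ring at its irrelevant ideal. -/
abbrev Loc (R : Type*) [CommRing R] [IsLocalRing R] : Type _ :=
  Localization.AtPrime (irrelevant (maximalIdeal R))

/-- The image of an initial form in the localization at the irrelevant ideal. -/
noncomputable def initialFormLoc (p : Σ e, ↥(maximalIdeal R ^ e)) : Loc R :=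
  algebraMap _ _ (initialForm _ p)

theorem ofList_map_initialFormLoc (L : List (Σ e, ↥(maximalIdeal R ^ e))) :
    Ideal.ofList (L.map initialFormLoc) =
      (Ideal.ofList (L.map (initialForm (maximalIdeal R)))).map (algebraMap _ (Loc R)) := by
  rw [Ideal.map_ofList, List.map_map]
  rfl

theorem mem_truncation_sup_of_leading_mem (L : List (Σ e, ↥(maximalIdeal R ^ e))) {k : ℕ}
    (r : ↥(maximalIdeal R ^ k))
    (h : algebraMap _ (Loc R) (leading _ k r) ∈ Ideal.ofList (L.map initialFormLoc)) :
    (r : R) ∈ truncation _ L k ⊔ maximalIdeal R ^ (k + 1) := by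
  rw [ofList_map_initialFormLoc, IsLocalization.algebraMap_mem_map_algebraMap_iff
    (irrelevant (maximalIdeal R)).primeCompl] at h
  obtain ⟨s, hs, hsr⟩ := h
  exact mem_truncation_sup_of_mul_leading_mem L r hs hsr

/-- The second conclusion is what lets the induction continue: it controls the initial forms of the
ideal when the next element is appended. -/
theorem isWeaklyRegular_values [IsNoetherianRing R] (L : List (Σ e, ↥(maximalIdeal R ^ e)))
    (hL : IsWeaklyRegular (Loc R) (L.map initialFormLoc)) :
    IsWeaklyRegular R (values _ L) ∧
      ∀ k, Ideal.ofList (values _ L) ⊓ maximalIdeal R ^ k ≤ truncation _ L k := by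
  induction L using List.reverseRecOn with
  | nil => exact ⟨IsWeaklyRegular.nil R R, by simp [values]⟩
  | append_singleton L p ih =>
    rw [List.map_append, isWeaklyRegular_append_iff, List.map_singleton,
      isWeaklyRegular_singleton_iff] at hL
    obtain ⟨h1, h2⟩ := hL
    obtain ⟨ih1, ih2⟩ := ih h1
    have hreg : ∀ k, ∀ r ∈ maximalIdeal R ^ k,
        (p.2 : R) * r ∈ truncation _ L (p.1 + k) ⊔ maximalIdeal R ^ (p.1 + k + 1) →
          r ∈ truncation _ L k ⊔ maximalIdeal R ^ (k + 1) := by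
      intro k r hr hpr
      refine mem_truncation_sup_of_leading_mem L ⟨r, hr⟩ ?_
      have h3 := (isSMulRegular_quotient_iff_mem_of_smul_mem _ _).mp h2
        (algebraMap _ (Loc R) (leading _ k ⟨r, hr⟩))
      rw [smul_eq_mul, Ideal.mul_top] at h3
      refine h3 ?_
      rw [smul_eq_mul, initialFormLoc, ← map_mul, ofList_map_initialFormLoc]
      refine Ideal.mem_map_of_mem _ ?_
      rw [initialForm, leading_mul]
      obtain ⟨a, ha, b, hb, hab⟩ := Submodule.mem_sup.mp hpr
      obtain ⟨ha', ha⟩ := leading_mem_of_mem_truncation _ L ha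
      have hb' := Ideal.pow_le_pow_right (Nat.le_succ _) hb
      have : mulPow (maximalIdeal R) p.2 ⟨r, hr⟩ = ⟨a, ha'⟩ + ⟨b, hb'⟩ := Subtype.ext hab.symm
      rw [this, leading_add, leading_eq_zero _ ⟨b, hb'⟩ hb, add_zero]
      exact ha
    have hle := truncation_le (maximalIdeal R) L
    have hval : values _ (L ++ [p]) = values (maximalIdeal R) L ++ [(p.2 : R)] := by simp [values]
    rw [hval, isWeaklyRegular_append_iff, isWeaklyRegular_singleton_iff]
    refine ⟨⟨ih1, ?_⟩, fun k => ?_⟩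
    · rw [isSMulRegular_quotient_iff_mem_of_smul_mem, smul_eq_mul, Ideal.mul_top]
      exact fun r hr => mem_of_mul_mem_of_initial hle ih2 p.2.2 hreg hr
    · rw [truncation_concat, Ideal.ofList_append, Ideal.ofList_singleton]
      exact sup_span_inf_pow_le_of_initial hle ih2 p.2.2 hreg k

end

end AssociatedGraded

/-! ### Zero-dimensional quotients -/

section

open IsLocalRing RingTheory.Sequence

/-- The quotient has dimension 0, so the maximal ideal is the only prime over `Ideal.ofList rs`. -/
theorem exists_maximalIdeal_pow_le_ofList {B : Type*} [CommRing B] [IsLocalRing B]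
    [IsNoetherianRing B] {rs : List B} (hrs : IsRegular B rs)
    (hlen : (rs.length : WithBot ℕ∞) = ringKrullDim B) :
    ∃ n, maximalIdeal B ^ n ≤ Ideal.ofList rs := by
  have h := ringKrullDim_add_length_eq_ringKrullDim_of_isRegular rs hrs
  rw [← hlen] at h
  have h0 : ringKrullDim (B ⧸ Ideal.ofList rs) ≤ 0 := by
    have h' : ringKrullDim (B ⧸ Ideal.ofList rs) + rs.length ≤ 0 + rs.length := by
      rw [h, zero_add]
    exact (ENat.WithBot.add_le_add_natCast_right_iff).mp h'
  have : Ring.KrullDimLE 0 (B ⧸ Ideal.ofList rs) :=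
    Order.krullDimLE_iff _ _ |>.mpr (by exact_mod_cast h0)
  have hrad : maximalIdeal B ≤ (Ideal.ofList rs).radical := by
    rw [Ideal.radical_eq_sInf]
    refine le_sInf fun p ⟨hp, hpp⟩ => ?_
    have : (p.map (Ideal.Quotient.mk (Ideal.ofList rs))).IsPrime :=
      Ideal.map_isPrime_of_surjective Ideal.Quotient.mk_surjective (by rwa [Ideal.mk_ker])
    have hmax := Ideal.IsPrime.isMaximal' (I := p.map (Ideal.Quotient.mk (Ideal.ofList rs)))
    have := Ideal.comap_isMaximal_of_surjective (Ideal.Quotient.mk (Ideal.ofList rs))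
      Ideal.Quotient.mk_surjective (K := p.map (Ideal.Quotient.mk (Ideal.ofList rs)))
    rw [Ideal.comap_map_of_surjective' _ Ideal.Quotient.mk_surjective, Ideal.mk_ker,
      sup_eq_left.mpr hp] at this
    exact (eq_maximalIdeal this).ge
  exact Ideal.exists_pow_le_of_le_radical_of_fg hrad (IsNoetherian.noetherian _)

end

/-! ### Regular sequences of initial forms and the descent to `R` -/

namespace AssociatedGraded

open IsLocalRing RingTheory.Sequence

variable {R : Type u} [CommRing R] [IsLocalRing R]

theorem initialFormLoc_mem_maximalIdeal {p : Σ e, ↥(maximalIdeal R ^ e)} (hp : 0 < p.1) :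
    initialFormLoc p ∈ maximalIdeal (Loc R) := by
  rw [← Localization.AtPrime.map_eq_maximalIdeal]
  exact Ideal.mem_map_of_mem _ (leading_mem_irrelevant _ hp _)

/-- A prime whose contraction contains all homogeneous elements of positive degree contains the
irrelevant ideal, hence is maximal. -/
theorem exists_initialFormLoc_notMem (T : Finset (Ideal (Loc R)))
    (hT : ∀ P ∈ T, P.IsPrime ∧ P ≠ maximalIdeal (Loc R)) :
    ∃ p : Σ e, ↥(maximalIdeal R ^ e), 0 < p.1 ∧ ∀ P ∈ T, initialFormLoc p ∉ P := by
  classical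
  obtain ⟨e, he, y, hy, hyT⟩ := exists_homogeneous_notMem
    (fun e => AddMonoidHom.mrange (DirectSum.of (Piece (maximalIdeal R)) e))
    (T.image (Ideal.comap (algebraMap _ (Loc R)))) (by
      simp only [Finset.mem_image, forall_exists_index, and_imp]
      rintro _ P hP rfl
      have := (hT P hP).1
      refine ⟨inferInstance, ?_⟩
      by_contra! h
      have hle : irrelevant (maximalIdeal R) ≤ P.comap (algebraMap _ (Loc R)) :=
        irrelevant_le _ fun e he x => h e he _ ((mem_mrange_of_iff _).mpr ⟨x, rfl⟩)
      rw [← Ideal.map_le_iff_le_comap, Localization.AtPrime.map_eq_maximalIdeal] at hle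
      exact (hT P hP).2 ((maximalIdeal.isMaximal _).eq_of_le this.ne_top hle).symm)
  obtain ⟨x, rfl⟩ := (mem_mrange_of_iff _).mp hy
  exact ⟨⟨e, x⟩, he, fun P hP => hyT _ (Finset.mem_image_of_mem _ hP)⟩

theorem exists_isRegular_initialFormLoc [IsNoetherianRing (AssociatedGradedRing (maximalIdeal R))]
    {bs : List (Loc R)} (hmem : ∀ b ∈ bs, b ∈ maximalIdeal (Loc R)) (hbs : IsRegular (Loc R) bs) :
    ∃ L : List (Σ e, ↥(maximalIdeal R ^ e)), L.length = bs.length ∧ (∀ p ∈ L, 0 < p.1) ∧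
      IsRegular (Loc R) (L.map initialFormLoc) := by
  have : IsNoetherianRing (Loc R) := IsLocalization.isNoetherianRing
    (irrelevant (maximalIdeal R)).primeCompl _ inferInstance
  let f : {p : Σ e, ↥(maximalIdeal R ^ e) // 0 < p.1} → Loc R := fun p => initialFormLoc p.1
  obtain ⟨ss, hlen, hss, hreg⟩ := exists_isRegular_of_avoid (Set.range f)
    (by rintro _ ⟨p, rfl⟩; exact initialFormLoc_mem_maximalIdeal p.2)
    (fun T hT => by
      obtain ⟨p, hp, hpT⟩ := exists_initialFormLoc_notMem T hT
      exact ⟨_, ⟨⟨p, hp⟩, rfl⟩, hpT⟩) bs.length rfl hmem hbs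
  obtain ⟨L, rfl⟩ : ss ∈ Set.range (List.map f) := by rw [Set.range_list_map]; exact hss
  refine ⟨L.map Subtype.val, by simpa using hlen, by simp; tauto, ?_⟩
  rw [List.map_map]
  exact hreg

/-- Nakayama: comparing leading forms in degree `n` gives `𝔪 ^ n ≤ J ⊔ 𝔪 * 𝔪 ^ n`, with `J`
generated by the values. -/
theorem maximalIdeal_pow_le_of_pow_le [IsNoetherianRing R] (L : List (Σ e, ↥(maximalIdeal R ^ e)))
    {n : ℕ} (hn : maximalIdeal (Loc R) ^ n ≤ Ideal.ofList (L.map initialFormLoc)) :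
    maximalIdeal R ^ n ≤ Ideal.ofList (values _ L) := by
  refine Submodule.le_of_le_smul_of_le_jacobson_bot (I := maximalIdeal R)
    (IsNoetherian.noetherian _) (maximalIdeal_le_jacobson _) fun r hr => ?_
  rw [smul_eq_mul, ← pow_succ']
  refine sup_le_sup_right (truncation_le _ L n) _
    (mem_truncation_sup_of_leading_mem L ⟨r, hr⟩ (hn ?_))
  rw [← Localization.AtPrime.map_eq_maximalIdeal, ← Ideal.map_pow]
  exact Ideal.mem_map_of_mem _ (leading_mem_irrelevant_pow _ n hr)

end AssociatedGraded

theorem lemma4 (R : Type*) [CommRing R] [IsLocalRing R] [IsNoetherianRing R]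
    (hA : IsCohenMacaulayRing (AssociatedGradedRing (IsLocalRing.maximalIdeal R))) :
    IsCohenMacaulayLocalRing R := by
  have := hA.localization_atMaximal (AssociatedGraded.irrelevant (IsLocalRing.maximalIdeal R))
  obtain ⟨bs, hmem, hbs, hlen⟩ := exists_isRegular_length_eq_ringKrullDim (AssociatedGraded.Loc R)
  obtain ⟨L, hL, hpos, hreg⟩ := AssociatedGraded.exists_isRegular_initialFormLoc hmem hbs
  obtain ⟨n, hn⟩ := exists_maximalIdeal_pow_le_ofList hreg (by rw [List.length_map, hL, hlen])
  have hval : ∀ r ∈ AssociatedGraded.values _ L, r ∈ IsLocalRing.maximalIdeal R := by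
    intro r hr
    obtain ⟨p, hp, rfl⟩ := List.mem_map.mp hr
    exact Ideal.pow_le_self (hpos p hp).ne' p.2.2
  exact isCohenMacaulayLocalRing_of_isRegular hval
    (.of_isWeaklyRegular_of_mem_maximalIdeal R hval (AssociatedGraded.isWeaklyRegular_values L hreg.1).1)
    (AssociatedGraded.maximalIdeal_pow_le_of_pow_le L hn)
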